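/- All Hilbert spaces are finite-dimensional. A game $G=(\mathcal X,\nu,\mathcal A,D)$ consists of finite sets $\mathcal X$ of questions and $\mathcal A$ of answers (the answer set may depend on the question), a probability distribution $\nu$ on $\mathcal X\times\mathcal X$ and a predicate $D(a,b|x,y)\in\{0,1\}$; it is symmetric if $\nu(x,y)=\nu(y,x)$ and $D(a,b|x,y)=D(b,a|y,x)$. A strategy $\mathcal S=(|\psi\rangle,A,B)$ consists of a unit vector $|\psi\rangle\in H_A\otimes H_B$ and POVMs $\{A^x_a\}_a$ on $H_A$, $\{B^y_b\}_b$ on $H_B$ for all $x,y\in\mathcal X$; it has correlation $C_{x,y,a,b}=\langle\psi|A^x_a\otimes B^y_b|\psi\rangle$, winning probability $\omega(G;\mathcal S)=\sum_{x,y}\nu(x,y)\sum_{a,b}D(a,b|x,y)C_{x,y,a,b}$, and, for a distribution $\mu$ on $\mathcal X$, asynchronicity $\delta_{\mathrm{sync}}(\mathcal S,\mu)=\sum_x\mu(x)\sum_{a\ne b}C_{x,x,a,b}$. The quantum value $\omega_q(G)$ is the supremum of $\omega(G;\mathcal S)$ over all strategies, and $\mathcal S$ is optimal if it attains it. An ME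 strategy is a strategy with $H_A=H_B=H$, $|\psi\rangle=\sum_i\sqrt{\lambda_i}\,|u_i\rangle\otimes|u_i\rangle$ for an orthonormal basis $(u_i)$ of $H$ and $\lambda_i\ge 0$, $B^x_a=(A^x_a)^T$ (transpose with respect to $(u_i)$), and $|\psi\rangle$ maximally entangled; it is a PME strategy if moreover all its POVMs are PVMs. For a distribution $\hat\nu$ on $\mathcal X\times\mathcal X$ with marginals $\hat\nu_A,\hat\nu_B$ and $\eta\ge0$, a strategy $\tilde{\mathcal S}=(|\tilde\psi\rangle,\tilde A,\tilde B)$ is a local $(\eta,\hat\nu)$-dilation of $\mathcal S=(|\psi\rangle,A,B)$ if there are isometries $V_A:H_A\to\tilde H_A\otimes K_A$, $V_B:H_B\to\tilde H_B\otimes K_B$ and a unit vector $|\mathrm{aux}\rangle\in K_A\otimes K_B$ such that, up to reordering tensor factors, $$\|(V_A\otimes V_B)|\psi\rangle-|\tilde\psi\rangle\otimes|\mathrm{aux}\rangle\|\le\eta,$$ $$\Big(\sum_x\hat\nu_A(x)\sum_a\|(V_A\otimes V_B)(A^x_a\otimes 1)|\psi\rangle-((\tilde A^x_a\otimes 1)|\tilde\psi\rangle)\otimes|\mathrm{aux}\rangle\|^2\Big)^{1/2}\le\eta,$$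 $$\Big(\sum_y\hat\nu_B(y)\sum_b\|(V_A\otimes V_B)(1\otimes B^y_b)|\psi\rangle-((1\otimes\tilde B^y_b)|\tilde\psi\rangle)\otimes|\mathrm{aux}\rangle\|^2\Big)^{1/2}\le\eta.$$ For $\kappa:\mathbb R_{\ge0}\to\mathbb R_{\ge0}$ with $\kappa(\epsilon)\to0$ as $\epsilon\to0$, the game $G$ $(\kappa,\hat\nu)$-PME-robustly self-tests an optimal PME strategy $\tilde{\mathcal S}$ if for all $\epsilon\ge0$ and every PME strategy $\mathcal S$ with $\omega(G;\mathcal S)\ge\omega_q(G)-\epsilon$, $\tilde{\mathcal S}$ is a local $(\kappa(\epsilon),\hat\nu)$-dilation of $\mathcal S$. **Lemma.** Let $G=(\mathcal X,\nu,\mathcal A,D)$ be a symmetric game, $\nu_A$ the marginal of $\nu$, $\hat\nu$ a symmetric probability distribution on $\mathcal X\times\mathcal X$ with marginal $\hat\nu_A$, and $c\ge1$ with $\hat\nu_A\le c\,\nu_A$ pointwise. Suppose that $G$ $(\kappa,\hat\nu)$-PME-robustly self-tests an optimal PME strategy $\tilde{\mathcal S}$. Then for every ME strategy $\mathcal S$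 with $\delta=\delta_{\mathrm{sync}}(\mathcal S,\nu_A)$ and every $\epsilon\ge 0$ with $\omega(G;\mathcal S)\ge\omega(G;\tilde{\mathcal S})-\epsilon$, $\tilde{\mathcal S}$ is a local $(\kappa'(\epsilon,\delta),\hat\nu)$-dilation of $\mathcal S$, where $$\kappa'(\epsilon,\delta)=\kappa\big(24\sqrt\delta+\epsilon\big)+3\sqrt{c\,\delta}.$$ -/

import Mathlib

open scoped TensorProduct NNReal InnerProductSpace Topology

universe u v w

namespace NonlocalGame

/-- A probability distribution on pairs of questions `X × X`. -/
structure PairDist (X : Type v) [Fintype X] where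
  prob : X → X → ℝ
  nonneg : ∀ x y, 0 ≤ prob x y
  sum_eq_one : ∑ x, ∑ y, prob x y = 1

/-- The marginal distribution on the first question. -/
def PairDist.marginalA {X : Type v} [Fintype X] (ν : PairDist X) (x : X) : ℝ :=
  ∑ y, ν.prob x y

/-- The marginal distribution on the second question. -/
def PairDist.marginalB {X : Type v} [Fintype X] (ν : PairDist X) (y : X) : ℝ :=
  ∑ x, ν.prob x y

def PairDist.IsSymm {X : Type v} [Fintype X] (ν : PairDist X) : Prop :=
  ∀ x y, ν.prob x y = ν.prob y x

/-- A two-player non-local game in which both players have the same questions `X` and the same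
answers; the set `𝒜 x` of answers may depend on the question `x`. The predicate `D x y a b` says
that the answers `a`, `b` to the questions `x`, `y` win. -/
structure Game (X : Type v) [Fintype X] (𝒜 : X → Type w) where
  ν : PairDist X
  D : (x y : X) → 𝒜 x → 𝒜 y → Prop

/-- A game is symmetric if exchanging the two players changes neither the question distribution nor
the winning predicate. -/
def Game.IsSymm {X : Type v} [Fintype X] {𝒜 : X → Type w} (G : Game X 𝒜) : Prop :=
  G.ν.IsSymm ∧ ∀ (x y : X) (a : 𝒜 x) (b : 𝒜 y), G.D x y a b ↔ G.D y x b a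

section Measurements

variable {H : Type u} [NormedAddCommGroup H] [InnerProductSpace ℂ H]
  {X : Type v} {𝒜 : X → Type w} [∀ x, Fintype (𝒜 x)]

/-- `A x` is a POVM with outcomes in `𝒜 x`, for every question `x`. -/
def IsPOVMFamily (A : (x : X) → 𝒜 x → (H →ₗ[ℂ] H)) : Prop :=
  ∀ x, (∀ a, (A x a).IsPositive) ∧ ∑ a, A x a = 1

/-- `A x` is a PVM (a POVM of mutually orthogonal projections), for every question `x`. -/
def IsPVMFamily (A : (x : X) → 𝒜 x → (H →ₗ[ℂ] H)) : Prop :=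
  IsPOVMFamily A ∧
    ∀ x, (∀ a, A x a * A x a = A x a) ∧ ∀ a b, a ≠ b → A x a * A x b = 0

end Measurements

/-- A (finite-dimensional) quantum strategy: a unit vector in `HA ⊗ HB` and POVMs on `HA` and
on `HB`. -/
structure Strategy (X : Type v) (𝒜 : X → Type w) [∀ x, Fintype (𝒜 x)] where
  HA : Type u
  HB : Type u
  [normedA : NormedAddCommGroup HA]
  [innerA : InnerProductSpace ℂ HA]
  [finA : FiniteDimensional ℂ HA]
  [normedB : NormedAddCommGroup HB]
  [innerB : InnerProductSpace ℂ HB]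
  [finB : FiniteDimensional ℂ HB]
  ψ : HA ⊗[ℂ] HB
  norm_ψ : ‖ψ‖ = 1
  A : (x : X) → 𝒜 x → (HA →ₗ[ℂ] HA)
  B : (x : X) → 𝒜 x → (HB →ₗ[ℂ] HB)
  povmA : IsPOVMFamily A
  povmB : IsPOVMFamily B

attribute [instance] Strategy.normedA Strategy.innerA Strategy.finA
  Strategy.normedB Strategy.innerB Strategy.finB

section Values

variable {X : Type v} [Fintype X] {𝒜 : X → Type w} [∀ x, Fintype (𝒜 x)]

/-- The correlation `⟨ψ| A x a ⊗ B y b |ψ⟩` (a real number, as the operator is positive). -/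
noncomputable def Strategy.corr (S : Strategy.{u} X 𝒜) (x y : X) (a : 𝒜 x) (b : 𝒜 y) : ℝ :=
  (⟪S.ψ, TensorProduct.map (S.A x a) (S.B y b) S.ψ⟫_ℂ).re

open Classical in
/-- The winning probability `ω(G; S)`. -/
noncomputable def Game.winProb (G : Game X 𝒜) (S : Strategy.{u} X 𝒜) : ℝ :=
  ∑ x, ∑ y, G.ν.prob x y * ∑ a, ∑ b, if G.D x y a b then S.corr x y a b else 0

/-- The quantum value of `G`: the supremum of the winning probabilities of all strategies. -/
noncomputable def Game.quantumValue (G : Game X 𝒜) : ℝ :=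
  ⨆ S : Strategy.{u} X 𝒜, G.winProb S

/-- `S` is optimal for `G`. -/
def Game.IsOptimal (G : Game X 𝒜) (S : Strategy.{u} X 𝒜) : Prop :=
  G.winProb S = Game.quantumValue.{u} G

open Classical in
/-- The asynchronicity of `S` with respect to a distribution `μ` on the questions. -/
noncomputable def Strategy.dsync (S : Strategy.{u} X 𝒜) (μ : X → ℝ) : ℝ :=
  ∑ x, μ x * ∑ a, ∑ b, if a ≠ b then S.corr x x a b else 0

/-- `St` is a local `(ε, ν)`-dilation of `S`. The map `tensorTensorTensorComm` only reorders the
tensor factors, `(H̃A ⊗ H̃B) ⊗ (KA ⊗ KB) ≃ (H̃A ⊗ KA) ⊗ (H̃B ⊗ KB)`. -/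
def IsLocalDilation (St S : Strategy.{u} X 𝒜) (ε : ℝ) (ν : PairDist X) : Prop :=
  ∃ (KA KB : Type u)
    (_ : NormedAddCommGroup KA) (_ : InnerProductSpace ℂ KA) (_ : FiniteDimensional ℂ KA)
    (_ : NormedAddCommGroup KB) (_ : InnerProductSpace ℂ KB) (_ : FiniteDimensional ℂ KB)
    (VA : S.HA →ₗᵢ[ℂ] (St.HA ⊗[ℂ] KA)) (VB : S.HB →ₗᵢ[ℂ] (St.HB ⊗[ℂ] KB))
    (aux : KA ⊗[ℂ] KB),
    ‖aux‖ = 1 ∧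
    ‖TensorProduct.mapIsometry VA VB S.ψ
        - TensorProduct.tensorTensorTensorComm ℂ St.HA St.HB KA KB (St.ψ ⊗ₜ[ℂ] aux)‖ ≤ ε ∧
    √(∑ x, ν.marginalA x * ∑ a,
        ‖TensorProduct.mapIsometry VA VB (TensorProduct.map (S.A x a) LinearMap.id S.ψ)
          - TensorProduct.tensorTensorTensorComm ℂ St.HA St.HB KA KB
              ((TensorProduct.map (St.A x a) LinearMap.id St.ψ) ⊗ₜ[ℂ] aux)‖ ^ 2) ≤ ε ∧
    √(∑ y, ν.marginalB y * ∑ b,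
        ‖TensorProduct.mapIsometry VA VB (TensorProduct.map LinearMap.id (S.B y b) S.ψ)
          - TensorProduct.tensorTensorTensorComm ℂ St.HA St.HB KA KB
              ((TensorProduct.map LinearMap.id (St.B y b) St.ψ) ⊗ₜ[ℂ] aux)‖ ^ 2) ≤ ε

/-- `G` `(κ, νh)`-robustly self-tests the optimal strategy `St ∈ C` for the class `C`. -/
structure RobustlySelfTests (G : Game X 𝒜) (κ : ℝ≥0 → ℝ≥0) (νh : PairDist X)
    (C : Set (Strategy.{u} X 𝒜)) (St : Strategy.{u} X 𝒜) : Prop where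
  mem : St ∈ C
  optimal : G.IsOptimal St
  tendsto : Filter.Tendsto κ (𝓝[≠] 0) (𝓝 0)
  dilation : ∀ (ε : ℝ≥0), ∀ S ∈ C, Game.quantumValue.{u} G - ε ≤ G.winProb S →
    IsLocalDilation St S (κ ε) νh

end Values

section Symmetric

variable {H : Type u} [NormedAddCommGroup H] [InnerProductSpace ℂ H]

/-- The transpose of an operator with respect to an orthonormal basis. -/
noncomputable def transposeOp {n : ℕ} (e : OrthonormalBasis (Fin n) ℂ H) (T : H →ₗ[ℂ] H) :
    H →ₗ[ℂ] H :=
  Matrix.toLin e.toBasis e.toBasis (LinearMap.toMatrix e.toBasis e.toBasis T).transpose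

open scoped ComplexOrder in
theorem isPOVMFamily_transposeOp {X : Type v} {𝒜 : X → Type w} [∀ x, Fintype (𝒜 x)]
    {n : ℕ} (e : OrthonormalBasis (Fin n) ℂ H) {A : (x : X) → 𝒜 x → (H →ₗ[ℂ] H)}
    (hA : IsPOVMFamily A) : IsPOVMFamily fun x a => transposeOp e (A x a) := by
  intro x
  refine ⟨fun a => ?_, ?_⟩
  · have h := ((LinearMap.posSemidef_toMatrix_iff e).2 ((hA x).1 a)).transpose
    refine (LinearMap.posSemidef_toMatrix_iff e).1 ?_
    simpa only [transposeOp, LinearMap.toMatrix_toLin] using h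
  · simp only [transposeOp]
    rw [← map_sum, ← Matrix.transpose_sum, ← map_sum, (hA x).2, LinearMap.toMatrix_one,
      Matrix.transpose_one, Matrix.toLin_one, Module.End.one_eq_id]

/-- `ψ` is maximally entangled: `ψ = ∑ i, (1/√d) α i ⊗ β i` for orthonormal bases `α`, `β` of two
spaces of the same dimension `d`. -/
def IsMaximallyEntangled {HA HB : Type u} [NormedAddCommGroup HA] [InnerProductSpace ℂ HA]
    [NormedAddCommGroup HB] [InnerProductSpace ℂ HB] (ψ : HA ⊗[ℂ] HB) : Prop :=
  ∃ (d : ℕ) (α : OrthonormalBasis (Fin d) ℂ HA) (β : OrthonormalBasis (Fin d) ℂ HB),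
    ψ = ∑ i, ((1 / √(d : ℝ) : ℝ) : ℂ) • (α i ⊗ₜ[ℂ] β i)

end Symmetric

/-- A symmetric strategy: both players hold a copy of `H`, the state is `∑ i, √(l i) e i ⊗ e i` for
an orthonormal basis `e` of `H`, Alice measures with `A`, and Bob measures with the transposes of
`A` with respect to `e`. -/
structure SymStrategy (X : Type v) (𝒜 : X → Type w) [∀ x, Fintype (𝒜 x)] where
  H : Type u
  [normed : NormedAddCommGroup H]
  [innerProd : InnerProductSpace ℂ H]
  [fin : FiniteDimensional ℂ H]
  n : ℕ
  e : OrthonormalBasis (Fin n) ℂ H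
  l : Fin n → ℝ
  l_nonneg : ∀ i, 0 ≤ l i
  norm_state : ‖∑ i, ((√(l i) : ℝ) : ℂ) • (e i ⊗ₜ[ℂ] e i)‖ = 1
  A : (x : X) → 𝒜 x → (H →ₗ[ℂ] H)
  povm : IsPOVMFamily A

attribute [instance] SymStrategy.normed SymStrategy.innerProd SymStrategy.fin

section SymClasses

variable {X : Type v} {𝒜 : X → Type w} [∀ x, Fintype (𝒜 x)]

noncomputable def SymStrategy.toStrategy (S : SymStrategy.{u} X 𝒜) : Strategy.{u} X 𝒜 where
  HA := S.H
  HB := S.H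
  ψ := ∑ i, ((√(S.l i) : ℝ) : ℂ) • (S.e i ⊗ₜ[ℂ] S.e i)
  norm_ψ := S.norm_state
  A := S.A
  B := fun x a => transposeOp S.e (S.A x a)
  povmA := S.povm
  povmB := isPOVMFamily_transposeOp S.e S.povm

/-- ME strategies: symmetric strategies with a maximally entangled state. -/
def SymStrategy.IsME (S : SymStrategy.{u} X 𝒜) : Prop :=
  IsMaximallyEntangled S.toStrategy.ψ

/-- PME strategies: projective ME strategies. -/
def SymStrategy.IsPME (S : SymStrategy.{u} X 𝒜) : Prop :=
  S.IsME ∧ IsPVMFamily S.toStrategy.A ∧ IsPVMFamily S.toStrategy.B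

/-- The class of all PME strategies. -/
def classPME (X : Type v) (𝒜 : X → Type w) [∀ x, Fintype (𝒜 x)] : Set (Strategy.{u} X 𝒜) :=
  {S | ∃ T : SymStrategy.{u} X 𝒜, T.IsPME ∧ T.toStrategy = S}

end SymClasses

end NonlocalGame

/-! A maximally entangled state turns correlations into normalized traces, `tr(A_a B_b)/n`. The
asynchronicity is therefore the `μ`-average of the defects `1 - ∑ tr(A_a²)/n`, which measure how far
each POVM is from being projective. By `exists_pvm_near` each POVM has a PVM `P` at squared
normalized Hilbert-Schmidt distance at most three times its defect. Replacing `A` by `P` and keeping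
the state gives a PME strategy, to which the self-test applies.

Two estimates transfer the conclusion back. Exchanging the measurements of both players changes the
winning probability by at most `10√δ` (`abs_sum_reTr_sub_mul_le`, then Jensen), so `24√δ + ε` is a
sufficient slack. Undoing the exchange in the dilation inequalities costs, by Minkowski, the
`νh`-averaged distance, at most `√(3cδ) ≤ 3√(cδ)`.

For the PVM, pool the eigenvectors of all the `A_a` and keep the `n` pairs (outcome, eigenvector)
with the largest eigenvalues. The kept vectors, scaled by the roots of their eigenvalues, are the
columns of a contraction. Its unitary polar part provides an orthonormal basis labelled by outcomes,
and `P_a` projects onto the vectors labelled `a`. -/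

namespace NonlocalGame

/-! ### Traces, operators between 0 and 1, and the two extremal facts behind orthogonalization -/

section Operators

variable {H : Type*} [NormedAddCommGroup H] [InnerProductSpace ℂ H]

/-- The real part of the trace. -/
noncomputable def reTr (T : H →ₗ[ℂ] H) : ℝ := (LinearMap.trace ℂ H T).re

theorem reTr_add (S T : H →ₗ[ℂ] H) : reTr (S + T) = reTr S + reTr T := by simp [reTr]

theorem reTr_sub (S T : H →ₗ[ℂ] H) : reTr (S - T) = reTr S - reTr T := by simp [reTr]

theorem reTr_sum {ι : Type*} (s : Finset ι) (T : ι → H →ₗ[ℂ] H) :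
    reTr (∑ i ∈ s, T i) = ∑ i ∈ s, reTr (T i) := by simp [reTr]

theorem reTr_mul_comm (S T : H →ₗ[ℂ] H) : reTr (S * T) = reTr (T * S) := by
  simp [reTr, LinearMap.trace_mul_comm ℂ S T]

theorem reTr_one [FiniteDimensional ℂ H] : reTr (1 : H →ₗ[ℂ] H) = Module.finrank ℂ H := by
  simp [reTr]

theorem reTr_eq_sum {ι : Type*} [Fintype ι] (T : H →ₗ[ℂ] H) (b : OrthonormalBasis ι ℂ H) :
    reTr T = ∑ i, (⟪b i, T (b i)⟫_ℂ).re := by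
  rw [reTr, LinearMap.trace_eq_sum_inner T b, Complex.re_sum]

theorem reTr_mul_eq_sum {ι : Type*} [Fintype ι] {S : H →ₗ[ℂ] H} (hS : S.IsSymmetric)
    (T : H →ₗ[ℂ] H) (b : OrthonormalBasis ι ℂ H) :
    reTr (S * T) = ∑ i, (⟪S (b i), T (b i)⟫_ℂ).re := by
  rw [reTr_eq_sum _ b]
  simp only [Module.End.mul_apply]
  exact Finset.sum_congr rfl fun i _ => by rw [hS]

theorem sum_norm_sq_apply {ι : Type*} [Fintype ι] {T : H →ₗ[ℂ] H} (hT : T.IsSymmetric)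
    (b : OrthonormalBasis ι ℂ H) : ∑ i, ‖T (b i)‖ ^ 2 = reTr (T * T) := by
  rw [reTr_mul_eq_sum hT T b]
  refine Finset.sum_congr rfl fun i _ => ?_
  rw [inner_self_eq_norm_sq_to_K]
  norm_cast

theorem reTr_mul_self_nonneg [FiniteDimensional ℂ H] {T : H →ₗ[ℂ] H} (hT : T.IsSymmetric) :
    0 ≤ reTr (T * T) := by
  rw [← sum_norm_sq_apply hT (stdOrthonormalBasis ℂ H)]
  positivity

/-- In an eigenbasis of `K` the trace is a sum of eigenvalues of `K` times diagonal entries of `M`.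
-/
theorem reTr_mul_nonneg [FiniteDimensional ℂ H] {K M : H →ₗ[ℂ] H} (hK : K.IsPositive)
    (hM : M.IsPositive) : 0 ≤ reTr (K * M) := by
  rw [reTr_mul_eq_sum hK.isSymmetric M (hK.isSymmetric.eigenvectorBasis rfl)]
  refine Finset.sum_nonneg fun i _ => ?_
  rw [hK.isSymmetric.apply_eigenvectorBasis, inner_smul_left, RCLike.conj_ofReal]
  erw [Complex.re_ofReal_mul]
  exact mul_nonneg (hK.nonneg_eigenvalues rfl i) (hM.re_inner_nonneg_right _)

theorem isPositive_mul_one_sub {M : H →ₗ[ℂ] H} (h0 : M.IsPositive) (h1 : (1 - M).IsPositive) :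
    (M * (1 - M)).IsPositive := by
  -- Both summands are conjugates of positive operators, so no square root of `M` is needed.
  have e : M * (1 - M) = M * (1 - M) * M + (1 - M) * M * (1 - M) := by noncomm_ring
  have s0 := h0.isSymmetric
  have s1 := h1.isSymmetric
  have c : ∀ v, M ((1 - M) v) = (1 - M) (M v) := fun v => by simp
  refine ⟨fun x y => ?_, fun x => ?_⟩
  · rw [Module.End.mul_apply, Module.End.mul_apply, s0, s1, c]
  · have k1 := h1.re_inner_nonneg_left (M x)
    have k2 := h0.re_inner_nonneg_left ((1 - M) x)
    rw [e, LinearMap.add_apply, inner_add_left, map_add]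
    refine add_nonneg ?_ ?_
    · rw [Module.End.mul_apply, Module.End.mul_apply, s0]
      exact k1
    · rw [Module.End.mul_apply, Module.End.mul_apply, s1]
      exact k2

/-- This is `M² ≤ M ≤ 1`, evaluated at `v`. -/
theorem norm_apply_le_of_isPositive {M : H →ₗ[ℂ] H} (h0 : M.IsPositive)
    (h1 : (1 - M).IsPositive) (v : H) : ‖M v‖ ≤ ‖v‖ := by
  have k1 := (isPositive_mul_one_sub h0 h1).re_inner_nonneg_left v
  have k2 := h1.re_inner_nonneg_left v
  have s0 := h0.isSymmetric
  have e1 : RCLike.re ⟪(M * (1 - M)) v, v⟫_ℂ = RCLike.re ⟪M v, v⟫_ℂ - ‖M v‖ ^ 2 := by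
    rw [Module.End.mul_apply, s0, LinearMap.sub_apply, inner_sub_left, map_sub, ← inner_self_eq_norm_sq (𝕜 := ℂ),
      Module.End.one_apply, s0 v v]
  have e2 : RCLike.re ⟪(1 - M) v, v⟫_ℂ = ‖v‖ ^ 2 - RCLike.re ⟪M v, v⟫_ℂ := by
    rw [LinearMap.sub_apply, inner_sub_left, map_sub, ← inner_self_eq_norm_sq (𝕜 := ℂ),
      Module.End.one_apply]
  have : ‖M v‖ ^ 2 ≤ ‖v‖ ^ 2 := by linarith
  exact le_of_sq_le_sq this (norm_nonneg _)

/-- Both sides are the trace of `X* Y`. -/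
theorem sum_inner_apply_eq {E F : Type*} [NormedAddCommGroup E] [InnerProductSpace ℂ E]
    [NormedAddCommGroup F] [InnerProductSpace ℂ F] [FiniteDimensional ℂ E]
    [FiniteDimensional ℂ F] {ι ι' : Type*} [Fintype ι] [Fintype ι'] (X Y : E →ₗ[ℂ] F)
    (b : OrthonormalBasis ι ℂ E) (b' : OrthonormalBasis ι' ℂ E) :
    ∑ i, ⟪X (b i), Y (b i)⟫_ℂ = ∑ i, ⟪X (b' i), Y (b' i)⟫_ℂ := by
  have h := LinearMap.trace_eq_sum_inner (LinearMap.adjoint X ∘ₗ Y) b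
  rw [LinearMap.trace_eq_sum_inner _ b'] at h
  simpa [LinearMap.adjoint_inner_right] using h.symm

/-- A contraction between spaces of the same dimension, given by the images `c t` of an orthonormal
basis, has a unitary polar part, the images `u t` of the same basis, which correlates with it. -/
theorem exists_orthonormalBasis_sum_re_inner_ge [FiniteDimensional ℂ H] {τ : Type*} [Fintype τ]
    (hτ : Fintype.card τ = Module.finrank ℂ H) (c : τ → H)
    (hc : ∀ v, ∑ t, ‖⟪c t, v⟫_ℂ‖ ^ 2 ≤ ‖v‖ ^ 2) :
    ∃ u : OrthonormalBasis τ ℂ H, ∑ t, ‖c t‖ ^ 2 ≤ ∑ t, (⟪c t, u t⟫_ℂ).re := by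
  classical
  let E := EuclideanSpace ℂ τ
  have hE : Module.finrank ℂ E = Module.finrank ℂ H := by rw [← hτ]; simp [E]
  let b : OrthonormalBasis τ ℂ E := EuclideanSpace.basisFun τ ℂ
  let X : E →ₗ[ℂ] H := b.toBasis.constr ℂ c
  have hX : ∀ t, X (b t) = c t := fun t => by
    have := b.toBasis.constr_basis ℂ c t
    rwa [b.coe_toBasis] at this
  have hG : (LinearMap.adjoint X ∘ₗ X).IsPositive := LinearMap.isPositive_adjoint_comp_self X
  let v := hG.isSymmetric.eigenvectorBasis hE
  let μ := hG.isSymmetric.eigenvalues hE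
  have hXX : ∀ i j, ⟪X (v i), X (v j)⟫_ℂ = if i = j then (μ j : ℂ) else 0 := fun i j => by
    have h : LinearMap.adjoint X (X (v j)) = (μ j : ℂ) • v j :=
      hG.isSymmetric.apply_eigenvectorBasis hE j
    rw [← LinearMap.adjoint_inner_right, h, inner_smul_right, orthonormal_iff_ite.mp v.orthonormal]
    split_ifs <;> simp
  have hn : ∀ j, ‖X (v j)‖ ^ 2 = μ j := fun j => by
    have := hXX j j
    rw [inner_self_eq_norm_sq_to_K] at this
    simp only [if_true] at this
    refine Complex.ofReal_injective (Eq.trans ?_ this)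
    push_cast
    rfl
  -- The `s j` are the singular values of `X`. Normalizing the nonzero `X (v j)` and extending to an
  -- orthonormal basis gives a unitary `U` even if `X` is not injective; `∑ ⟪c t, U (b t)⟫` is then
  -- the trace norm of `X`.
  let s : Fin (Module.finrank ℂ H) → ℝ := fun j => ‖X (v j)‖
  let u0 : Fin (Module.finrank ℂ H) → H := fun j => ((s j)⁻¹ : ℂ) • X (v j)
  have hu0 : Orthonormal ℂ (({j | s j ≠ 0} : Set _).domRestrict u0) := by
    rw [orthonormal_iff_ite]
    rintro ⟨i, hi⟩ ⟨j, hj⟩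
    have hj' : (s j : ℂ) ≠ 0 := by exact_mod_cast hj
    simp only [Set.domRestrict_apply, u0, inner_smul_left, inner_smul_right, hXX, Subtype.mk.injEq]
    split_ifs with h
    · subst h
      rw [← hn]
      simp only [map_inv₀, Complex.conj_ofReal]
      change (s i : ℂ)⁻¹ * ((s i : ℂ)⁻¹ * ((s i ^ 2 : ℝ) : ℂ)) = 1
      push_cast
      field_simp
    · simp
  obtain ⟨u', hu'⟩ := hu0.exists_orthonormalBasis_extension_of_card_eq (by simp)
  let U : E ≃ₗᵢ[ℂ] H := v.equiv u' (Equiv.refl _)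
  have hU : ∀ j, U (v j) = u' j := fun j => by simp [U]
  refine ⟨b.map U, ?_⟩
  have hXU : ∀ j, ⟪X (v j), U (v j)⟫_ℂ = s j := fun j => by
    by_cases h : s j = 0
    · have : X (v j) = 0 := norm_eq_zero.mp h
      rw [this, inner_zero_left, h, Complex.ofReal_zero]
    · have h' : (s j : ℂ) ≠ 0 := by exact_mod_cast h
      rw [hU, hu' j h]
      simp only [u0]
      rw [inner_smul_right, inner_self_eq_norm_sq_to_K]
      change (s j : ℂ)⁻¹ * (s j : ℂ) ^ 2 = s j
      field_simp
  have h1 : ∑ t, ⟪c t, (b.map U) t⟫_ℂ = ∑ j, (s j : ℂ) := by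
    have := sum_inner_apply_eq X (U.toLinearEquiv : E →ₗ[ℂ] H) b v
    simp only [hX] at this
    rw [← Finset.sum_congr rfl fun j _ => hXU j]
    simpa using this
  have h2 : ∑ t, ‖c t‖ ^ 2 = ∑ j, s j ^ 2 := by
    have := sum_inner_apply_eq X X b v
    simp only [hX, inner_self_eq_norm_sq_to_K] at this
    exact_mod_cast this
  -- The hypothesis says that the adjoint of `X` is a contraction; at `X (v j)` it reads `s j ^ 4 ≤
  -- s j ^ 2`.
  have hs : ∀ j, s j ≤ 1 := fun j => by
    have h3 := hc (X (v j))
    have h4 : ∑ t, ‖⟪c t, X (v j)⟫_ℂ‖ ^ 2 = ‖LinearMap.adjoint X (X (v j))‖ ^ 2 := by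
      rw [← b.sum_sq_norm_inner_right]
      simp only [LinearMap.adjoint_inner_right, hX]
    have h5 : LinearMap.adjoint X (X (v j)) = (μ j : ℂ) • v j :=
      hG.isSymmetric.apply_eigenvectorBasis hE j
    rw [h4, h5, norm_smul, v.orthonormal.1 j, ← hn] at h3
    have h6 : (s j ^ 2) ^ 2 ≤ s j ^ 2 := by
      simpa [s] using h3
    have h7 : 0 ≤ s j := norm_nonneg _
    by_contra! h
    have h8 : 1 < s j ^ 2 := by nlinarith
    nlinarith
  rw [← Complex.re_sum, h1, h2, ← Complex.ofReal_sum, Complex.ofReal_re]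
  refine Finset.sum_le_sum fun j _ => ?_
  have h7 : 0 ≤ s j := norm_nonneg _
  nlinarith [hs j]

/-- The `m` largest of numbers in `[0, 1]` with sum `m` sum to at least the sum of the squares. -/
theorem exists_finset_card_eq_sum_sq_le {ι : Type*} [Fintype ι] (f : ι → ℝ)
    (h0 : ∀ i, 0 ≤ f i) (h1 : ∀ i, f i ≤ 1) (m : ℕ) (hm : ∑ i, f i = m) :
    ∃ T : Finset ι, T.card = m ∧ ∑ i, f i ^ 2 ≤ ∑ i ∈ T, f i := by
  classical
  have hcard : m ≤ (Finset.univ : Finset ι).card := by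
    have : (m : ℝ) ≤ (Finset.univ : Finset ι).card := by
      rw [← hm]
      simpa using Finset.sum_le_sum fun i (_ : i ∈ Finset.univ) => h1 i
    exact_mod_cast this
  obtain ⟨T, hT, hmax⟩ := (Finset.powersetCard m (Finset.univ : Finset ι)).exists_max_image
    (fun T => ∑ i ∈ T, f i) (Finset.powersetCard_nonempty.mpr hcard)
  have hTc : T.card = m := (Finset.mem_powersetCard.mp hT).2
  refine ⟨T, hTc, ?_⟩
  have hswap : ∀ t ∈ T, ∀ s ∉ T, f s ≤ f t := fun t ht s hs => by
    have hs' : s ∉ T.erase t := fun h => hs (Finset.mem_of_mem_erase h)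
    have h := hmax (insert s (T.erase t)) (Finset.mem_powersetCard.mpr ⟨Finset.subset_univ _, by
      rw [Finset.card_insert_of_notMem hs', Finset.card_erase_add_one ht, hTc]⟩)
    simp only [Finset.sum_insert hs'] at h
    linarith [Finset.add_sum_erase T f ht]
  -- A threshold `θ` separates `T` from its complement, so `∑_{Tᶜ} f² ≤ θ ∑_{Tᶜ} f = θ ∑_T (1 - f) ≤
  -- ∑_T (f - f²)`; the middle equality is the condition that the total is `m = |T|`.
  obtain ⟨θ, hθT, hθ⟩ : ∃ θ, (∀ t ∈ T, θ ≤ f t) ∧ ∀ s ∉ T, f s ≤ θ := by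
    rcases T.eq_empty_or_nonempty with rfl | hne
    · exact ⟨1, by simp, fun s _ => h1 s⟩
    · obtain ⟨t, ht, hmin⟩ := T.exists_min_image f hne
      exact ⟨f t, hmin, fun s hs => hswap t ht s hs⟩
  have e1 := Finset.sum_add_sum_compl T f
  have e2 := Finset.sum_add_sum_compl T fun i => f i ^ 2
  have e3 : ∑ i ∈ Tᶜ, f i ^ 2 ≤ θ * ∑ i ∈ Tᶜ, f i := by
    rw [Finset.mul_sum]
    refine Finset.sum_le_sum fun i hi => ?_
    nlinarith [hθ i (Finset.mem_compl.mp hi), h0 i]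
  have e4 : θ * ∑ i ∈ T, (1 - f i) ≤ ∑ i ∈ T, (f i - f i ^ 2) := by
    rw [Finset.mul_sum]
    refine Finset.sum_le_sum fun i hi => ?_
    nlinarith [hθT i hi, h1 i]
  rw [Finset.sum_sub_distrib, Finset.sum_sub_distrib, Finset.sum_const, hTc] at e4
  have e5 : ∑ i ∈ Tᶜ, f i = m - ∑ i ∈ T, f i := by linarith
  rw [e5] at e3
  simp only [nsmul_eq_mul, mul_one] at e4
  linarith

end Operators

/-! ### Rounding a POVM to a PVM, and the effect on coarse-grained traces -/

section Orthogonalization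

variable {H : Type*} [NormedAddCommGroup H] [InnerProductSpace ℂ H]

theorem one_sub_isPositive_of_sum_eq_one {ι : Type*} [Fintype ι] {A : ι → H →ₗ[ℂ] H}
    (hA : ∀ a, (A a).IsPositive) (hsum : ∑ a, A a = 1) (p : ι → Prop) [DecidablePred p] :
    (1 - ∑ a, if p a then A a else 0).IsPositive := by
  have : 1 - (∑ a, if p a then A a else 0) = ∑ a, if p a then 0 else A a := by
    rw [← hsum, ← Finset.sum_sub_distrib]
    exact Finset.sum_congr rfl fun a _ => by split_ifs <;> simp
  rw [this]
  refine LinearMap.isPositive_sum _ fun a _ => ?_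
  split_ifs
  exacts [LinearMap.isPositive_zero, hA a]

/-- The projection onto the span of the members of an orthonormal basis that are labelled `a`. -/
noncomputable def labelProj {ι τ : Type*} [Fintype τ] [DecidableEq ι]
    (u : OrthonormalBasis τ ℂ H) (f : τ → ι) (a : ι) : H →ₗ[ℂ] H :=
  ∑ t, if f t = a then (InnerProductSpace.rankOne ℂ (u t) (u t)).toLinearMap else 0

section LabelProj

variable {ι τ : Type*} [Fintype τ] [DecidableEq ι] (u : OrthonormalBasis τ ℂ H) (f : τ → ι)

theorem labelProj_apply_basis (a : ι) (t : τ) :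
    labelProj u f a (u t) = if f t = a then u t else 0 := by
  classical
  have : ∀ s, (if f s = a then (InnerProductSpace.rankOne ℂ (u s) (u s)).toLinearMap else 0) (u t)
      = if s = t then (if f t = a then u t else 0) else 0 := fun s => by
    have h := orthonormal_iff_ite.mp u.orthonormal s t
    by_cases hst : s = t
    · subst hst
      split_ifs <;> simp_all
    · rw [if_neg hst] at h
      split_ifs <;> simp_all
  rw [labelProj, LinearMap.sum_apply, Finset.sum_congr rfl fun s _ => this s]
  simp

theorem labelProj_isPositive (a : ι) : (labelProj u f a).IsPositive := by
  refine LinearMap.isPositive_sum _ fun t _ => ?_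
  split_ifs
  · exact (InnerProductSpace.isPositive_rankOne_self (u t)).toLinearMap
  · exact LinearMap.isPositive_zero

theorem sum_labelProj [Fintype ι] : ∑ a, labelProj u f a = 1 := by
  refine u.toBasis.ext fun t => ?_
  rw [u.coe_toBasis, LinearMap.sum_apply]
  simp [labelProj_apply_basis]

theorem labelProj_mul_self (a : ι) : labelProj u f a * labelProj u f a = labelProj u f a := by
  refine u.toBasis.ext fun t => ?_
  rw [u.coe_toBasis, Module.End.mul_apply, labelProj_apply_basis]
  split_ifs with h
  · rw [labelProj_apply_basis, if_pos h]
  · simp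

theorem labelProj_mul_of_ne {a b : ι} (hab : a ≠ b) : labelProj u f a * labelProj u f b = 0 := by
  refine u.toBasis.ext fun t => ?_
  rw [u.coe_toBasis, Module.End.mul_apply, labelProj_apply_basis]
  split_ifs with h
  · rw [labelProj_apply_basis, if_neg (by rw [h]; exact hab.symm)]
    simp
  · simp

theorem sum_reTr_mul_labelProj [Fintype ι] (A : ι → H →ₗ[ℂ] H) :
    ∑ a, reTr (A a * labelProj u f a) = ∑ t, (⟪u t, A (f t) (u t)⟫_ℂ).re := by
  simp_rw [fun a => reTr_eq_sum (A a * labelProj u f a) u]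
  rw [Finset.sum_comm]
  refine Finset.sum_congr rfl fun t _ => ?_
  have : ∀ a, (⟪u t, (A a * labelProj u f a) (u t)⟫_ℂ).re
      = if f t = a then (⟪u t, A a (u t)⟫_ℂ).re else 0 := fun a => by
    rw [Module.End.mul_apply, labelProj_apply_basis]
    split_ifs <;> simp
  rw [Finset.sum_congr rfl fun a _ => this a]
  simp

end LabelProj

variable [FiniteDimensional ℂ H]

theorem re_inner_apply_eq_sum_eigenvalues {T : H →ₗ[ℂ] H} (hT : T.IsSymmetric) (v : H) :
    (⟪v, T v⟫_ℂ).re = ∑ k, hT.eigenvalues rfl k * ‖⟪hT.eigenvectorBasis rfl k, v⟫_ℂ‖ ^ 2 := by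
  rw [← (hT.eigenvectorBasis rfl).sum_inner_mul_inner, Complex.re_sum]
  refine Finset.sum_congr rfl fun k _ => ?_
  rw [← hT (hT.eigenvectorBasis rfl k) v, hT.apply_eigenvectorBasis, inner_smul_left,
    RCLike.conj_ofReal, mul_left_comm]
  erw [Complex.re_ofReal_mul]
  rw [← inner_conj_symm, Complex.conj_mul']
  norm_cast

theorem reTr_mul_self_eq_sum_eigenvalues {T : H →ₗ[ℂ] H} (hT : T.IsSymmetric) :
    reTr (T * T) = ∑ k, hT.eigenvalues rfl k ^ 2 := by
  rw [← sum_norm_sq_apply hT (hT.eigenvectorBasis rfl)]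
  refine Finset.sum_congr rfl fun k _ => ?_
  rw [hT.apply_eigenvectorBasis, norm_smul, (hT.eigenvectorBasis rfl).orthonormal.1]
  simp

/-- Orthogonalization: a POVM is close to a PVM, in the Hilbert-Schmidt norm, when it is
almost projective. -/
theorem exists_pvm_near {ι : Type*} [Fintype ι] (A : ι → H →ₗ[ℂ] H)
    (hA : ∀ a, (A a).IsPositive) (hsum : ∑ a, A a = 1) :
    ∃ P : ι → H →ₗ[ℂ] H, (∀ a, (P a).IsPositive) ∧ ∑ a, P a = 1 ∧ (∀ a, P a * P a = P a) ∧
      (∀ a b, a ≠ b → P a * P b = 0) ∧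
      ∑ a, reTr ((A a - P a) * (A a - P a)) ≤
        3 * (Module.finrank ℂ H - ∑ a, reTr (A a * A a)) := by
  classical
  set n := Module.finrank ℂ H with hn
  let W : ∀ a, OrthonormalBasis (Fin n) ℂ H := fun a => (hA a).isSymmetric.eigenvectorBasis rfl
  let lam : ι × Fin n → ℝ := fun i => (hA i.1).isSymmetric.eigenvalues rfl i.2
  let wv : ι × Fin n → H := fun i => W i.1 i.2
  have hwv : ∀ i, ‖wv i‖ = 1 := fun i => (W i.1).orthonormal.1 i.2
  have hform : ∀ a v, (⟪v, A a v⟫_ℂ).re = ∑ k, lam (a, k) * ‖⟪wv (a, k), v⟫_ℂ‖ ^ 2 :=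
    fun a v => re_inner_apply_eq_sum_eigenvalues (hA a).isSymmetric v
  have hone : ∀ v, ∑ a, (⟪v, A a v⟫_ℂ).re = ‖v‖ ^ 2 := fun v => by
    rw [← Complex.re_sum, ← inner_sum, ← LinearMap.sum_apply, hsum, Module.End.one_apply,
      ← inner_self_eq_norm_sq (𝕜 := ℂ)]
    rfl
  have h0 : ∀ i, 0 ≤ lam i := fun i => (hA i.1).nonneg_eigenvalues rfl i.2
  have h1 : ∀ i, lam i ≤ 1 := fun i => by
    have e : (⟪wv i, A i.1 (wv i)⟫_ℂ).re = lam i := by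
      have : A i.1 (wv i) = (lam i : ℂ) • wv i :=
        (hA i.1).isSymmetric.apply_eigenvectorBasis rfl i.2
      rw [this, inner_smul_right, Complex.re_ofReal_mul]
      have := inner_self_eq_norm_sq (𝕜 := ℂ) (wv i)
      rw [hwv] at this
      change (⟪wv i, wv i⟫_ℂ).re = 1 ^ 2 at this
      rw [this]
      ring
    have h := hone (wv i)
    rw [hwv] at h
    rw [← e]
    refine (Finset.single_le_sum (f := fun a => (⟪wv i, A a (wv i)⟫_ℂ).re)
      (fun a _ => (hA a).re_inner_nonneg_right (wv i)) (Finset.mem_univ i.1)).trans ?_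
    rw [h]
    norm_num
  have hlam : ∑ i, lam i = n := by
    have h : reTr (1 : H →ₗ[ℂ] H) = n := reTr_one
    rw [Fintype.sum_prod_type, ← h, ← hsum, reTr_sum]
    exact Finset.sum_congr rfl fun a _ =>
      ((hA a).isSymmetric.re_trace_eq_sum_eigenvalues rfl).symm
  have hlam2 : ∑ i, lam i ^ 2 = ∑ a, reTr (A a * A a) := by
    rw [Fintype.sum_prod_type]
    exact Finset.sum_congr rfl fun a _ =>
      (reTr_mul_self_eq_sum_eigenvalues (hA a).isSymmetric).symm
  obtain ⟨T, hT, hTsum⟩ := exists_finset_card_eq_sum_sq_le lam h0 h1 n hlam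
  -- Since `∑ lam_i |w_i⟩⟨w_i|` over all pairs is `∑ A_a = 1`, its part over `T` is at most 1, which
  -- is the contraction hypothesis `hc`.
  let c : T → H := fun t => ((√(lam t) : ℝ) : ℂ) • wv t
  have hcin : ∀ (t : T) v, ‖⟪c t, v⟫_ℂ‖ ^ 2 = lam t * ‖⟪wv t, v⟫_ℂ‖ ^ 2 := fun t v => by
    simp only [c]
    rw [inner_smul_left, norm_mul, mul_pow, RCLike.norm_conj, Complex.norm_real, Real.norm_eq_abs,
      sq_abs, Real.sq_sqrt (h0 _)]
  have hc : ∀ v, ∑ t, ‖⟪c t, v⟫_ℂ‖ ^ 2 ≤ ‖v‖ ^ 2 := fun v => by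
    simp_rw [hcin]
    rw [Finset.sum_coe_sort T fun t => lam t * ‖⟪wv t, v⟫_ℂ‖ ^ 2, ← hone v]
    refine (Finset.sum_le_univ_sum_of_nonneg fun t => mul_nonneg (h0 t) (sq_nonneg _)).trans ?_
    rw [Fintype.sum_prod_type]
    exact le_of_eq (Finset.sum_congr rfl fun a _ => (hform a v).symm)
  obtain ⟨b, hb⟩ := exists_orthonormalBasis_sum_re_inner_ge (by simp [hT, hn]) c hc
  have hcn : ∑ t, ‖c t‖ ^ 2 = ∑ t ∈ T, lam t := by
    rw [← Finset.sum_coe_sort T lam]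
    refine Finset.sum_congr rfl fun t _ => ?_
    simp only [c]
    rw [norm_smul, hwv, mul_one, Complex.norm_real, Real.norm_eq_abs, sq_abs, Real.sq_sqrt (h0 _)]
  let P := labelProj b (fun t : T => t.1.1)
  refine ⟨P, labelProj_isPositive _ _, sum_labelProj _ _, labelProj_mul_self _ _,
    fun a a' => labelProj_mul_of_ne _ _, ?_⟩
  set L := ∑ a, reTr (A a * A a) with hL
  have hL0 : 0 ≤ L := Finset.sum_nonneg fun a _ => reTr_mul_self_nonneg (hA a).isSymmetric
  -- One spectral term of `A` at its label already bounds `⟪b t, A (b t)⟫` below by `|⟪c t, b t⟫|²`.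
  -- Cauchy-Schwarz over the `n` indices and `L ≤ ∑ Re ⟪c t, b t⟫` finish.
  have hcross : L ^ 2 ≤ n * ∑ a, reTr (A a * P a) := by
    rw [sum_reTr_mul_labelProj]
    have k1 : ∀ t : T, (⟪c t, b t⟫_ℂ).re ^ 2 ≤ (⟪b t, A t.1.1 (b t)⟫_ℂ).re := fun t => by
      rw [hform]
      refine le_trans ?_ (Finset.single_le_sum
        (f := fun k => lam (t.1.1, k) * ‖⟪wv (t.1.1, k), b t⟫_ℂ‖ ^ 2)
        (fun k _ => mul_nonneg (h0 _) (sq_nonneg _)) (Finset.mem_univ t.1.2))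
      refine le_trans ?_ (hcin t (b t)).le
      exact sq_le_sq.mpr (by simpa using Complex.abs_re_le_norm _)
    have k2 : L ≤ ∑ t, (⟪c t, b t⟫_ℂ).re := by
      rw [← hlam2]
      exact hTsum.trans (hcn ▸ hb)
    refine (pow_le_pow_left₀ hL0 k2 2).trans ((sq_sum_le_card_mul_sum_sq).trans ?_)
    rw [Finset.card_univ, Fintype.card_coe, hT]
    exact mul_le_mul_of_nonneg_left (Finset.sum_le_sum fun t _ => k1 t) (Nat.cast_nonneg _)
  have hPtr : ∑ a, reTr (P a * P a) = n := by
    rw [Finset.sum_congr rfl fun a _ => congrArg reTr (labelProj_mul_self _ _ a), ← reTr_sum,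
      sum_labelProj, reTr_one]
  have hexp : ∑ a, reTr ((A a - P a) * (A a - P a)) = L + n - 2 * ∑ a, reTr (A a * P a) := by
    rw [hL, ← hPtr, Finset.mul_sum, ← Finset.sum_add_distrib, ← Finset.sum_sub_distrib]
    refine Finset.sum_congr rfl fun a _ => ?_
    have : (A a - P a) * (A a - P a) = A a * A a + P a * P a - (A a * P a + P a * A a) := by
      noncomm_ring
    rw [this, reTr_sub, reTr_add, reTr_add, reTr_mul_comm (P a) (A a)]
    ring
  rw [hexp]
  have hn0 : (0 : ℝ) ≤ n := Nat.cast_nonneg _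
  set R := ∑ a, reTr (A a * P a)
  -- For `n > 0` this is `R ≥ L²/n ≥ 2L - n`, the last step being `(L - n)² ≥ 0`.
  suffices 2 * L - n ≤ R by linarith
  rcases hn0.eq_or_lt with h | h
  · have hR : 0 ≤ R := Finset.sum_nonneg fun a _ => reTr_mul_nonneg (hA a) (labelProj_isPositive _ _ a)
    rw [← h] at hcross ⊢
    have : L = 0 := by nlinarith
    rw [this]
    linarith
  · refine le_of_mul_le_mul_left ?_ h
    nlinarith [sq_nonneg (L - n)]

/-- Coarse-graining one POVM by subeffects `M a` is stable under Hilbert-Schmidt perturbations. -/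
theorem abs_sum_reTr_sub_mul_le {ι : Type*} [Fintype ι] {A P M : ι → H →ₗ[ℂ] H}
    (hA : ∀ a, (A a).IsPositive) (hAsum : ∑ a, A a = 1)
    (hP : ∀ a, (P a).IsPositive) (hPsum : ∑ a, P a = 1) (hPP : ∀ a, P a * P a = P a)
    (hM : ∀ a, (M a).IsPositive) (hM1 : ∀ a, (1 - M a).IsPositive) :
    |∑ a, reTr ((A a - P a) * M a)| ≤
      2 * √(∑ a, reTr ((A a - P a) * (A a - P a))) * √(Module.finrank ℂ H)
        + (Module.finrank ℂ H - ∑ a, reTr (A a * A a)) := by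
  classical
  let e := stdOrthonormalBasis ℂ H
  let F : ι → H →ₗ[ℂ] H := fun a => A a - P a
  have hF : ∀ a, (F a).IsSymmetric := fun a => (hA a).isSymmetric.sub (hP a).isSymmetric
  have hA1 : ∀ a, (1 - A a).IsPositive := fun a => by
    simpa using one_sub_isPositive_of_sum_eq_one hA hAsum fun a' => a' = a
  set n := ((Module.finrank ℂ H : ℕ) : ℝ) with hn
  have hK : ∀ a, reTr (A a * (1 - A a)) = reTr (A a) - reTr (A a * A a) := fun a => by
    rw [mul_sub, mul_one, reTr_sub]
  have htrA : ∑ a, reTr (A a) = n := by rw [← reTr_sum, hAsum, reTr_one]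
  -- Cauchy-Schwarz over pairs of an outcome and a basis vector
  have cs : ∀ Q : ι → H →ₗ[ℂ] H, (∀ a, (Q a).IsSymmetric) → ∑ a, reTr (Q a * Q a) ≤ n →
      ∑ a, ∑ i, ‖Q a (e i)‖ * ‖F a (e i)‖ ≤ √(∑ a, reTr (F a * F a)) * √n := fun Q hQ hQn => by
    simp_rw [← Fintype.sum_prod_type']
    refine (Real.sum_mul_le_sqrt_mul_sqrt _ _ _).trans ?_
    rw [mul_comm]
    simp_rw [Fintype.sum_prod_type, fun a => sum_norm_sq_apply (hF a) e,
      fun a => sum_norm_sq_apply (hQ a) e]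
    gcongr
  have b1 : |∑ a, reTr (F a * P a * M a)| ≤ √(∑ a, reTr (F a * F a)) * √n := by
    refine le_trans ?_ (cs P (fun a => (hP a).isSymmetric) ?_)
    · refine (Finset.abs_sum_le_sum_abs _ _).trans (Finset.sum_le_sum fun a _ => ?_)
      rw [mul_assoc, reTr_mul_comm, mul_assoc, reTr_mul_eq_sum (hP a).isSymmetric _ e]
      refine (Finset.abs_sum_le_sum_abs _ _).trans (Finset.sum_le_sum fun i _ => ?_)
      refine (Complex.abs_re_le_norm _).trans ((norm_inner_le_norm _ _).trans ?_)
      gcongr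
      exact norm_apply_le_of_isPositive (hM a) (hM1 a) _
    · rw [Finset.sum_congr rfl fun a _ => congrArg reTr (hPP a), ← reTr_sum, hPsum, reTr_one]
  have b2 : |∑ a, reTr (A a * F a * M a)| ≤ √(∑ a, reTr (F a * F a)) * √n := by
    refine le_trans ?_ (cs A (fun a => (hA a).isSymmetric) ?_)
    · refine (Finset.abs_sum_le_sum_abs _ _).trans (Finset.sum_le_sum fun a _ => ?_)
      rw [mul_assoc, reTr_mul_comm, mul_assoc, reTr_mul_eq_sum (hF a) _ e]
      refine (Finset.abs_sum_le_sum_abs _ _).trans (Finset.sum_le_sum fun i _ => ?_)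
      refine (Complex.abs_re_le_norm _).trans ((norm_inner_le_norm _ _).trans ?_)
      rw [mul_comm]
      gcongr
      exact norm_apply_le_of_isPositive (hM a) (hM1 a) _
    · rw [← htrA]
      refine Finset.sum_le_sum fun a _ => ?_
      have := (hK a) ▸ reTr_mul_nonneg (hA a) (hA1 a)
      linarith
  have b3 : |∑ a, reTr (A a * (1 - A a) * M a)| ≤ n - ∑ a, reTr (A a * A a) := by
    rw [← htrA, ← Finset.sum_sub_distrib]
    refine (Finset.abs_sum_le_sum_abs _ _).trans (Finset.sum_le_sum fun a _ => ?_)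
    have p := isPositive_mul_one_sub (hA a) (hA1 a)
    have p1 := reTr_mul_nonneg p (hM a)
    have p2 := reTr_mul_nonneg p (hM1 a)
    rw [mul_sub _ 1 (M a), mul_one, reTr_sub, hK] at p2
    rw [abs_of_nonneg p1]
    linarith
  -- Direct Cauchy-Schwarz against `M` would involve `∑ tr(M_a²)`, which can grow with the number of
  -- outcomes. Writing `A - P² = (A - P)P + A(A - P) + A(1 - A)` puts a factor `P` or `A` next to
  -- each difference, and `∑ tr(P_a²)` and `∑ tr(A_a²)` are at most `n`.
  have hsplit : ∑ a, reTr ((A a - P a) * M a) = ∑ a, reTr (F a * P a * M a)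
      + ∑ a, reTr (A a * F a * M a) + ∑ a, reTr (A a * (1 - A a) * M a) := by
    rw [← Finset.sum_add_distrib, ← Finset.sum_add_distrib]
    refine Finset.sum_congr rfl fun a _ => ?_
    rw [← reTr_add, ← reTr_add]
    congr 1
    have : F a * P a * M a + A a * F a * M a + A a * (1 - A a) * M a
        = (A a - P a * P a) * M a := by
      simp only [F]
      noncomm_ring
    rw [this, hPP]
  rw [hsplit]
  have t1 := abs_add_le (∑ a, reTr (F a * P a * M a) + ∑ a, reTr (A a * F a * M a))
    (∑ a, reTr (A a * (1 - A a) * M a))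
  have t2 := abs_add_le (∑ a, reTr (F a * P a * M a)) (∑ a, reTr (A a * F a * M a))
  change _ ≤ 2 * √(∑ a, reTr (F a * F a)) * √n + _
  linarith

end Orthogonalization

/-! ### Transposition in an orthonormal basis -/

section Transpose

variable {H : Type*} [NormedAddCommGroup H] [InnerProductSpace ℂ H] {n : ℕ}
  (e : OrthonormalBasis (Fin n) ℂ H)

theorem inner_transposeOp (T : H →ₗ[ℂ] H) (i j : Fin n) :
    ⟪e i, transposeOp e T (e j)⟫_ℂ = ⟪e j, T (e i)⟫_ℂ := by
  have h : transposeOp e T (e j) = ∑ k, ⟪e j, T (e k)⟫_ℂ • e k := by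
    have := Matrix.toLin_self e.toBasis e.toBasis
      (LinearMap.toMatrix e.toBasis e.toBasis T).transpose j
    simpa [transposeOp, LinearMap.toMatrix_apply, OrthonormalBasis.repr_apply_apply] using this
  rw [h, inner_sum]
  simp [inner_smul_right, orthonormal_iff_ite.mp e.orthonormal]

theorem sum_norm_sq_transposeOp (T : H →ₗ[ℂ] H) :
    ∑ i, ‖transposeOp e T (e i)‖ ^ 2 = ∑ i, ‖T (e i)‖ ^ 2 := by
  simp_rw [← e.sum_sq_norm_inner_right, inner_transposeOp]
  exact Finset.sum_comm

theorem transposeOp_mul (S T : H →ₗ[ℂ] H) :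
    transposeOp e (S * T) = transposeOp e T * transposeOp e S := by
  simp only [transposeOp]
  rw [LinearMap.toMatrix_mul, Matrix.transpose_mul, Matrix.toLin_mul e.toBasis e.toBasis e.toBasis]
  rfl

theorem transposeOp_zero : transposeOp e (0 : H →ₗ[ℂ] H) = 0 := by
  simp [transposeOp]

theorem transposeOp_sub (S T : H →ₗ[ℂ] H) :
    transposeOp e (S - T) = transposeOp e S - transposeOp e T := by
  simp [transposeOp]

theorem isPVMFamily_transposeOp {X : Type v} {𝒜 : X → Type w} [∀ x, Fintype (𝒜 x)]
    {P : (x : X) → 𝒜 x → (H →ₗ[ℂ] H)} (hP : IsPVMFamily P) :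
    IsPVMFamily fun x a => transposeOp e (P x a) := by
  refine ⟨isPOVMFamily_transposeOp e hP.1, fun x => ⟨fun a => ?_, fun a b hab => ?_⟩⟩
  · rw [← transposeOp_mul, (hP.2 x).1]
  · rw [← transposeOp_mul, (hP.2 x).2 b a hab.symm, transposeOp_zero]

theorem norm_sq_sum_tmul_basis (s : ℂ) (x : Fin n → H) :
    ‖∑ i, s • (x i ⊗ₜ[ℂ] e i)‖ ^ 2 = ‖s‖ ^ 2 * ∑ i, ‖x i‖ ^ 2 := by
  rw [← Finset.smul_sum, norm_smul, mul_pow, ← inner_self_eq_norm_sq (𝕜 := ℂ) (∑ i, _), sum_inner]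
  simp [inner_sum, orthonormal_iff_ite.mp e.orthonormal, ← Complex.ofReal_pow]

theorem norm_sq_sum_basis_tmul (s : ℂ) (x : Fin n → H) :
    ‖∑ i, s • (e i ⊗ₜ[ℂ] x i)‖ ^ 2 = ‖s‖ ^ 2 * ∑ i, ‖x i‖ ^ 2 := by
  rw [← Finset.smul_sum, norm_smul, mul_pow, ← inner_self_eq_norm_sq (𝕜 := ℂ) (∑ i, _), sum_inner]
  simp [inner_sum, orthonormal_iff_ite.mp e.orthonormal, ← Complex.ofReal_pow]

end Transpose

/-! ### Maximally entangled states and the trace -/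

section MaximallyEntangled

variable {H : Type u} [NormedAddCommGroup H] [InnerProductSpace ℂ H] {n : ℕ}
  (e : OrthonormalBasis (Fin n) ℂ H)

/-- The bases witnessing maximal entanglement need not be `e`. Contracting the first factor with `e
i` gives a vector of squared norm `l i` from one expansion and `1/d` from the other. -/
theorem schmidt_coeff_eq_of_isMaximallyEntangled (l : Fin n → ℝ) (hl : ∀ i, 0 ≤ l i)
    (h : IsMaximallyEntangled (∑ i, ((√(l i) : ℝ) : ℂ) • (e i ⊗ₜ[ℂ] e i))) (i : Fin n) :
    l i = 1 / n := by
  obtain ⟨d, α, β, h⟩ := h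
  have hd : d = n := by
    have h1 := Module.finrank_eq_card_basis α.toBasis
    have h2 := Module.finrank_eq_card_basis e.toBasis
    simp only [Fintype.card_fin] at h1 h2
    exact h1.symm.trans h2
  have e1 : ∀ j, ‖⟪e i ⊗ₜ[ℂ] e j, ∑ i, ((√(l i) : ℝ) : ℂ) • (e i ⊗ₜ[ℂ] e i)⟫_ℂ‖ ^ 2
      = if i = j then l i else 0 := fun j => by
    simp only [inner_sum, TensorProduct.smul_tmul', inner_smul_right, TensorProduct.inner_tmul,
      orthonormal_iff_ite.mp e.orthonormal]
    by_cases hij : i = j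
    · subst hij
      simp [Real.sq_sqrt (hl i)]
    · simp [hij]
  have e2 : ∀ j, ‖⟪e i ⊗ₜ[ℂ] e j, ∑ i, ((1 / √(d : ℝ) : ℝ) : ℂ) • (α i ⊗ₜ[ℂ] β i)⟫_ℂ‖ ^ 2
      = 1 / d * ‖⟪e j, ∑ k, ⟪e i, α k⟫_ℂ • β k⟫_ℂ‖ ^ 2 := fun j => by
    rw [← Finset.smul_sum, inner_smul_right, norm_mul, mul_pow, Complex.norm_real,
      Real.norm_eq_abs, sq_abs, div_pow, Real.sq_sqrt (Nat.cast_nonneg _), one_pow, inner_sum,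
      inner_sum]
    simp [inner_smul_right]
  have e3 : ‖∑ k, ⟪e i, α k⟫_ℂ • β k‖ ^ 2 = 1 := by
    rw [← β.sum_sq_norm_inner_right]
    simp only [inner_sum, inner_smul_right, orthonormal_iff_ite.mp β.orthonormal, mul_ite, mul_one,
      mul_zero, Finset.sum_ite_eq, Finset.mem_univ, if_true]
    rw [α.sum_sq_norm_inner_left, e.orthonormal.1, one_pow]
  have e4 := Finset.sum_congr rfl fun j (_ : j ∈ Finset.univ) => e1 j
  rw [h, Finset.sum_congr rfl fun j _ => e2 j, ← Finset.mul_sum, e.sum_sq_norm_inner_right,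
    e3] at e4
  rw [← hd]
  simpa using e4.symm

/-- The maximally entangled state of an orthonormal basis. -/
noncomputable def meState : H ⊗[ℂ] H := ∑ i, ((√(1 / n) : ℝ) : ℂ) • (e i ⊗ₜ[ℂ] e i)

theorem inner_meState_map_transposeOp {A : H →ₗ[ℂ] H} (hA : A.IsSymmetric) (B : H →ₗ[ℂ] H) :
    (⟪meState e, TensorProduct.map A (transposeOp e B) (meState e)⟫_ℂ).re
      = reTr (A * B) / n := by
  have hc : ((√(1 / n) : ℝ) : ℂ) * ((√(1 / n) : ℝ) : ℂ) = ((1 / n : ℝ) : ℂ) := by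
    rw [← Complex.ofReal_mul, Real.mul_self_sqrt (by positivity)]
  have h : ⟪meState e, TensorProduct.map A (transposeOp e B) (meState e)⟫_ℂ
      = ((1 / n : ℝ) : ℂ) * ∑ i, ⟪e i, (A * B) (e i)⟫_ℂ := by
    simp only [meState, map_sum, TensorProduct.smul_tmul', TensorProduct.map_tmul, map_smul,
      sum_inner, inner_sum, TensorProduct.inner_tmul, inner_smul_left, inner_smul_right,
      Complex.conj_ofReal, inner_transposeOp, Finset.mul_sum]
    refine (Finset.sum_comm.trans ?_)
    refine Finset.sum_congr rfl fun i _ => ?_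
    rw [Module.End.mul_apply, ← hA, ← e.sum_inner_mul_inner, Finset.mul_sum]
    refine Finset.sum_congr rfl fun j _ => ?_
    rw [hA, ← hc]
    ring
  rw [h, Complex.re_ofReal_mul, Complex.re_sum, ← reTr_eq_sum]
  ring

theorem norm_sq_map_left_meState {F : H →ₗ[ℂ] H} (hF : F.IsSymmetric) :
    ‖TensorProduct.map F LinearMap.id (meState e)‖ ^ 2 = reTr (F * F) / n := by
  rw [meState, map_sum]
  simp only [map_smul, TensorProduct.map_tmul, LinearMap.id_apply]
  rw [norm_sq_sum_tmul_basis, sum_norm_sq_apply hF, Complex.norm_real, Real.norm_eq_abs, sq_abs,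
    Real.sq_sqrt (by positivity)]
  ring

theorem norm_sq_map_right_meState {F : H →ₗ[ℂ] H} (hF : F.IsSymmetric) :
    ‖TensorProduct.map LinearMap.id (transposeOp e F) (meState e)‖ ^ 2 = reTr (F * F) / n := by
  rw [meState, map_sum]
  simp only [map_smul, TensorProduct.map_tmul, LinearMap.id_apply]
  rw [norm_sq_sum_basis_tmul, sum_norm_sq_transposeOp, sum_norm_sq_apply hF, Complex.norm_real,
    Real.norm_eq_abs, sq_abs, Real.sq_sqrt (by positivity)]
  ring

end MaximallyEntangled

/-! ### Tracial form of ME strategies, and asynchronicity as average defect -/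

section Defect

variable {X : Type v} {𝒜 : X → Type w} [∀ x, Fintype (𝒜 x)] {S : SymStrategy.{u} X 𝒜}

theorem SymStrategy.finrank_eq (S : SymStrategy.{u} X 𝒜) : Module.finrank ℂ S.H = S.n := by
  simpa using Module.finrank_eq_card_basis S.e.toBasis

theorem SymStrategy.n_pos (S : SymStrategy.{u} X 𝒜) : (0 : ℝ) < S.n := by
  rcases Nat.eq_zero_or_pos S.n with h | h
  · have := S.norm_state
    have : IsEmpty (Fin S.n) := by rw [h]; infer_instance
    simp_all
  · exact_mod_cast h

theorem SymStrategy.state_eq_of_isME (hS : S.IsME) : S.toStrategy.ψ = meState S.e := by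
  change ∑ i, ((√(S.l i) : ℝ) : ℂ) • (S.e i ⊗ₜ[ℂ] S.e i) = _
  refine Finset.sum_congr rfl fun i _ => ?_
  rw [schmidt_coeff_eq_of_isMaximallyEntangled S.e S.l S.l_nonneg hS i]

theorem SymStrategy.corr_eq_of_isME (hS : S.IsME) (x y : X) (a : 𝒜 x) (b : 𝒜 y) :
    S.toStrategy.corr x y a b = reTr (S.A x a * S.A y b) / S.n := by
  rw [Strategy.corr, S.state_eq_of_isME hS]
  exact inner_meState_map_transposeOp S.e ((S.povm x).1 a).isSymmetric _

/-- The failure of the measurement for the question `x` to be projective. -/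
noncomputable def SymStrategy.defect (S : SymStrategy.{u} X 𝒜) (x : X) : ℝ :=
  1 - (∑ a, reTr (S.A x a * S.A x a)) / S.n

theorem SymStrategy.sum_reTr (S : SymStrategy.{u} X 𝒜) (x : X) :
    ∑ a, reTr (S.A x a) = S.n := by
  rw [← NonlocalGame.reTr_sum, (S.povm x).2, reTr_one, S.finrank_eq]

theorem SymStrategy.defect_nonneg (S : SymStrategy.{u} X 𝒜) (x : X) : 0 ≤ S.defect x := by
  classical
  rw [SymStrategy.defect, sub_nonneg, div_le_one S.n_pos, ← S.sum_reTr x]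
  refine Finset.sum_le_sum fun a _ => ?_
  have h1 : (1 - S.A x a).IsPositive := by
    simpa using one_sub_isPositive_of_sum_eq_one (S.povm x).1 (S.povm x).2 fun a' => a' = a
  have := reTr_mul_nonneg ((S.povm x).1 a) h1
  rw [mul_sub, mul_one, reTr_sub] at this
  linarith

theorem SymStrategy.defect_le_one (S : SymStrategy.{u} X 𝒜) (x : X) : S.defect x ≤ 1 := by
  rw [SymStrategy.defect, sub_le_self_iff]
  exact div_nonneg (Finset.sum_nonneg fun a _ =>
    reTr_mul_self_nonneg ((S.povm x).1 a).isSymmetric) S.n_pos.le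

theorem SymStrategy.dsync_eq_of_isME [Fintype X] (hS : S.IsME) (μ : X → ℝ) :
    S.toStrategy.dsync μ = ∑ x, μ x * S.defect x := by
  classical
  refine Finset.sum_congr rfl fun x _ => congrArg (μ x * ·) ?_
  -- All answer pairs together have probability 1, so the off-diagonal ones have 1 minus the
  -- diagonal, which is the defect.
  have h1 : ∑ a, ∑ b, reTr (S.A x a * S.A x b) = S.n := by
    rw [← S.finrank_eq, ← reTr_one (H := S.H), ← mul_one (1 : S.H →ₗ[ℂ] S.H), ← (S.povm x).2,
      Finset.sum_mul_sum, NonlocalGame.reTr_sum]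
    simp only [NonlocalGame.reTr_sum]
  have h2 : ∀ a b, (if a ≠ b then S.toStrategy.corr x x a b else 0)
      = reTr (S.A x a * S.A x b) / S.n
        - if a = b then reTr (S.A x a * S.A x a) / S.n else 0 := fun a b => by
    rw [S.corr_eq_of_isME hS]
    by_cases h : a = b <;> simp [h]
  simp only [h2, Finset.sum_sub_distrib, Finset.sum_ite_eq, Finset.mem_univ, if_true,
    ← Finset.sum_div, h1]
  rw [div_self S.n_pos.ne', SymStrategy.defect]

end Defect

/-- Minkowski's inequality in the `μ`-weighted `ℓ²` space over pairs of a question and an answer,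
with `√μ` absorbed into the functions. -/
theorem sqrt_sum_mul_sum_sq_add_le {X : Type v} [Fintype X] {𝒜 : X → Type w}
    [∀ x, Fintype (𝒜 x)] {μ : X → ℝ} (hμ : ∀ x, 0 ≤ μ x) {h f g : (x : X) → 𝒜 x → ℝ}
    (hh : ∀ x a, 0 ≤ h x a) (hle : ∀ x a, h x a ≤ f x a + g x a) :
    √(∑ x, μ x * ∑ a, h x a ^ 2) ≤
      √(∑ x, μ x * ∑ a, f x a ^ 2) + √(∑ x, μ x * ∑ a, g x a ^ 2) := by
  have hexp : ∀ k : (x : X) → 𝒜 x → ℝ,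
      ∑ x, μ x * ∑ a, k x a ^ 2 = ∑ s : (x : X) × 𝒜 x, (√(μ s.1) * k s.1 s.2) ^ 2 := fun k => by
    rw [Fintype.sum_sigma]
    refine Finset.sum_congr rfl fun x _ => ?_
    rw [Finset.mul_sum]
    refine Finset.sum_congr rfl fun a _ => ?_
    rw [mul_pow, Real.sq_sqrt (hμ x)]
  simp only [hexp]
  set F := ∑ s : (x : X) × 𝒜 x, (√(μ s.1) * f s.1 s.2) ^ 2 with hF
  set G := ∑ s : (x : X) × 𝒜 x, (√(μ s.1) * g s.1 s.2) ^ 2 with hG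
  have hF0 : 0 ≤ F := Finset.sum_nonneg fun _ _ => sq_nonneg _
  have hG0 : 0 ≤ G := Finset.sum_nonneg fun _ _ => sq_nonneg _
  refine Real.sqrt_le_iff.mpr ⟨by positivity, ?_⟩
  rw [add_sq, Real.sq_sqrt hF0, Real.sq_sqrt hG0, mul_assoc]
  have cs := Real.sum_mul_le_sqrt_mul_sqrt Finset.univ
    (fun s : (x : X) × 𝒜 x => √(μ s.1) * f s.1 s.2) (fun s => √(μ s.1) * g s.1 s.2)
  rw [← hF, ← hG] at cs
  have key : ∑ s : (x : X) × 𝒜 x, (√(μ s.1) * h s.1 s.2) ^ 2 ≤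
      F + 2 * ∑ s : (x : X) × 𝒜 x, (√(μ s.1) * f s.1 s.2) * (√(μ s.1) * g s.1 s.2) + G := by
    rw [hF, hG, Finset.mul_sum, ← Finset.sum_add_distrib, ← Finset.sum_add_distrib]
    refine Finset.sum_le_sum fun s _ => ?_
    have h1 : (√(μ s.1) * h s.1 s.2) ^ 2 ≤ (√(μ s.1) * (f s.1 s.2 + g s.1 s.2)) ^ 2 :=
      pow_le_pow_left₀ (mul_nonneg (Real.sqrt_nonneg _) (hh _ _))
        (mul_le_mul_of_nonneg_left (hle _ _) (Real.sqrt_nonneg _)) 2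
    linarith
  linarith

section Marginals

variable {X : Type v} [Fintype X]

theorem PairDist.marginalA_nonneg (ν : PairDist X) (x : X) : 0 ≤ ν.marginalA x :=
  Finset.sum_nonneg fun y _ => ν.nonneg x y

theorem PairDist.sum_marginalA (ν : PairDist X) : ∑ x, ν.marginalA x = 1 := ν.sum_eq_one

theorem PairDist.IsSymm.marginalB_eq {ν : PairDist X} (hν : ν.IsSymm) :
    ν.marginalB = ν.marginalA :=
  funext fun x => Finset.sum_congr rfl fun y _ => hν y x

theorem sum_mul_sqrt_le {p : X → ℝ} (hp : ∀ x, 0 ≤ p x) (hp1 : ∑ x, p x = 1) {f : X → ℝ}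
    (hf : ∀ x, 0 ≤ f x) : ∑ x, p x * √(f x) ≤ √(∑ x, p x * f x) :=
  Real.strictConcaveOn_sqrt.concaveOn.le_map_sum (fun x _ => hp x) hp1 fun x _ => hf x

end Marginals

/-! ### Stability of local dilations under a change of measurements -/

section Perturbation

variable {E F E' F' : Type*} [NormedAddCommGroup E] [InnerProductSpace ℂ E]
  [NormedAddCommGroup F] [InnerProductSpace ℂ F] [NormedAddCommGroup E'] [InnerProductSpace ℂ E']
  [NormedAddCommGroup F'] [InnerProductSpace ℂ F']

theorem norm_mapIsometry_sub_le (VA : E →ₗᵢ[ℂ] E') (VB : F →ₗᵢ[ℂ] F') (φ χ : E ⊗[ℂ] F)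
    (z : E' ⊗[ℂ] F') :
    ‖TensorProduct.mapIsometry VA VB φ - z‖ ≤ ‖TensorProduct.mapIsometry VA VB χ - z‖ + ‖φ - χ‖ := by
  rw [← (TensorProduct.mapIsometry VA VB).norm_map (φ - χ), map_sub, add_comm]
  exact norm_sub_le_norm_sub_add_norm_sub _ _ _

theorem norm_mapIsometry_map_left_sub_le (VA : E →ₗᵢ[ℂ] E') (VB : F →ₗᵢ[ℂ] F') (ψ : E ⊗[ℂ] F)
    (S T : E →ₗ[ℂ] E) (z : E' ⊗[ℂ] F') :
    ‖TensorProduct.mapIsometry VA VB (TensorProduct.map S LinearMap.id ψ) - z‖ ≤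
      ‖TensorProduct.mapIsometry VA VB (TensorProduct.map T LinearMap.id ψ) - z‖
        + ‖TensorProduct.map (S - T) LinearMap.id ψ‖ := by
  have h : TensorProduct.map (S - T) LinearMap.id ψ
      = TensorProduct.map S LinearMap.id ψ - TensorProduct.map T LinearMap.id ψ := by
    rw [eq_sub_iff_add_eq, ← LinearMap.add_apply, ← TensorProduct.map_add_left, sub_add_cancel]
  rw [h]
  exact norm_mapIsometry_sub_le VA VB _ _ z

theorem norm_mapIsometry_map_right_sub_le (VA : E →ₗᵢ[ℂ] E') (VB : F →ₗᵢ[ℂ] F') (ψ : E ⊗[ℂ] F)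
    (S T : F →ₗ[ℂ] F) (z : E' ⊗[ℂ] F') :
    ‖TensorProduct.mapIsometry VA VB (TensorProduct.map LinearMap.id S ψ) - z‖ ≤
      ‖TensorProduct.mapIsometry VA VB (TensorProduct.map LinearMap.id T ψ) - z‖
        + ‖TensorProduct.map LinearMap.id (S - T) ψ‖ := by
  have h : TensorProduct.map LinearMap.id (S - T) ψ
      = TensorProduct.map LinearMap.id S ψ - TensorProduct.map LinearMap.id T ψ := by
    rw [eq_sub_iff_add_eq, ← LinearMap.add_apply, ← TensorProduct.map_add_right, sub_add_cancel]
  rw [h]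
  exact norm_mapIsometry_sub_le VA VB _ _ z

end Perturbation

variable {X : Type v} {𝒜 : X → Type w} [∀ x, Fintype (𝒜 x)]

/-- The symmetric strategy with the same state and other measurements. -/
noncomputable def SymStrategy.withMeas (S : SymStrategy.{u} X 𝒜) (P : (x : X) → 𝒜 x → S.H →ₗ[ℂ] S.H)
    (hP : IsPOVMFamily P) : SymStrategy.{u} X 𝒜 :=
  { S with A := P, povm := hP }

theorem IsLocalDilation.of_withMeas [Fintype X] {St : Strategy.{u} X 𝒜} {S : SymStrategy.{u} X 𝒜}
    {P : (x : X) → 𝒜 x → S.H →ₗ[ℂ] S.H} {hP : IsPOVMFamily P} {ν : PairDist X} {η σ : ℝ}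
    (hσ : 0 ≤ σ) (hν : ν.IsSymm)
    (h : IsLocalDilation St (S.withMeas P hP).toStrategy η ν)
    (hA : √(∑ x, ν.marginalA x * ∑ a, ‖TensorProduct.map (S.A x a - P x a) LinearMap.id
      S.toStrategy.ψ‖ ^ 2) ≤ σ)
    (hB : √(∑ x, ν.marginalA x * ∑ a, ‖TensorProduct.map LinearMap.id
      (transposeOp S.e (S.A x a - P x a)) S.toStrategy.ψ‖ ^ 2) ≤ σ) :
    IsLocalDilation St S.toStrategy (η + σ) ν := by
  obtain ⟨KA, KB, i1, i2, i3, i4, i5, i6, (VA : S.H →ₗᵢ[ℂ] St.HA ⊗[ℂ] KA),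
    (VB : S.H →ₗᵢ[ℂ] St.HB ⊗[ℂ] KB), aux, haux, h1, h2, h3⟩ := h
  -- The same isometries and auxiliary state serve: the state is unchanged, so only the two
  -- measurement inequalities pay `σ`.
  refine ⟨KA, KB, i1, i2, i3, i4, i5, i6, VA, VB, aux, haux, h1.trans (by linarith), ?_, ?_⟩
  · exact le_trans (sqrt_sum_mul_sum_sq_add_le ν.marginalA_nonneg (fun _ _ => norm_nonneg _)
      fun x a => norm_mapIsometry_map_left_sub_le (E := S.H) (F := S.H) VA VB S.toStrategy.ψ
        (S.A x a) (P x a) _) (add_le_add h2 hA)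
  · rw [hν.marginalB_eq] at h3 ⊢
    simp only [transposeOp_sub] at hB
    exact le_trans (sqrt_sum_mul_sum_sq_add_le ν.marginalA_nonneg (fun _ _ => norm_nonneg _)
      fun x a => norm_mapIsometry_map_right_sub_le (E := S.H) (F := S.H) VA VB S.toStrategy.ψ
        (transposeOp S.e (S.A x a)) (transposeOp S.e (P x a)) _) (add_le_add h3 hB)

/-! ### Change of the winning probability -/

section Value

variable {H : Type*} [NormedAddCommGroup H] [InnerProductSpace ℂ H] [FiniteDimensional ℂ H]

open Classical in
theorem abs_sum_ite_reTr_sub_le {ι ι' : Type*} [Fintype ι] [Fintype ι'] {A P : ι → H →ₗ[ℂ] H}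
    {B : ι' → H →ₗ[ℂ] H} (hA : ∀ a, (A a).IsPositive) (hAsum : ∑ a, A a = 1)
    (hP : ∀ a, (P a).IsPositive) (hPsum : ∑ a, P a = 1) (hPP : ∀ a, P a * P a = P a)
    (hB : ∀ b, (B b).IsPositive) (hBsum : ∑ b, B b = 1) (D : ι → ι' → Prop)
    {n δ : ℝ} (hn : n = Module.finrank ℂ H) (hn0 : 0 < n)
    (hδ : δ = 1 - (∑ a, reTr (A a * A a)) / n) (hδ0 : 0 ≤ δ) (hδ1 : δ ≤ 1)
    (hnear : ∑ a, reTr ((A a - P a) * (A a - P a)) ≤ 3 * (n * δ)) :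
    |∑ a, ∑ b, (if D a b then reTr (A a * B b) / n else 0)
      - ∑ a, ∑ b, (if D a b then reTr (P a * B b) / n else 0)| ≤ 5 * √δ := by
  let M : ι → H →ₗ[ℂ] H := fun a => ∑ b, if D a b then B b else 0
  have hM : ∀ a, (M a).IsPositive := fun a => LinearMap.isPositive_sum _ fun b _ => by
    split_ifs
    exacts [hB b, LinearMap.isPositive_zero]
  have h1 := abs_sum_reTr_sub_mul_le hA hAsum hP hPsum hPP hM
    fun a => one_sub_isPositive_of_sum_eq_one hB hBsum (D a)
  have hL : ∑ a, reTr (A a * A a) = n - n * δ := by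
    rw [hδ]
    field_simp
    ring
  rw [← hn, hL] at h1
  have e : ∑ a, ∑ b, (if D a b then reTr (A a * B b) / n else 0)
      - ∑ a, ∑ b, (if D a b then reTr (P a * B b) / n else 0)
      = (∑ a, reTr ((A a - P a) * M a)) / n := by
    rw [Finset.sum_div, ← Finset.sum_sub_distrib]
    refine Finset.sum_congr rfl fun a _ => ?_
    rw [Finset.mul_sum, reTr_sum, Finset.sum_div, ← Finset.sum_sub_distrib]
    refine Finset.sum_congr rfl fun b _ => ?_
    split_ifs
    · rw [sub_mul, reTr_sub]
      ring
    · simp [reTr]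
  rw [e, abs_div, abs_of_pos hn0, div_le_iff₀ hn0]
  -- Here `√3` is rounded up to 2; twice this plus `n * δ ≤ n * √δ` makes the constant 5.
  have h2 : √(∑ a, reTr ((A a - P a) * (A a - P a))) * √n ≤ 2 * √δ * n := by
    rw [← Real.sqrt_mul' _ hn0.le]
    refine Real.sqrt_le_iff.mpr ⟨by positivity, ?_⟩
    rw [mul_pow, mul_pow, Real.sq_sqrt hδ0]
    nlinarith [mul_le_mul_of_nonneg_right hnear hn0.le, mul_nonneg hδ0 (sq_nonneg n)]
  have h3 : δ ≤ √δ := Real.le_sqrt_of_sq_le (by nlinarith)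
  have h4 : n * δ ≤ √δ * n := by nlinarith
  linarith

end Value

open Classical in
theorem SymStrategy.abs_winProb_sub_withMeas_le [Fintype X] (G : Game X 𝒜) (hG : G.IsSymm)
    {S : SymStrategy.{u} X 𝒜} (hS : S.IsME) {P : (x : X) → 𝒜 x → S.H →ₗ[ℂ] S.H}
    (hP : IsPOVMFamily P) (hPP : ∀ x a, P x a * P x a = P x a)
    (hnear : ∀ x, ∑ a, reTr ((S.A x a - P x a) * (S.A x a - P x a)) ≤ 3 * (S.n * S.defect x)) :
    |G.winProb S.toStrategy - G.winProb (S.withMeas P hP).toStrategy| ≤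
      10 * √(S.toStrategy.dsync G.ν.marginalA) := by
  have hS' : (S.withMeas P hP).IsME := hS
  have hc : ∀ x y a b, (S.withMeas P hP).toStrategy.corr x y a b
      = reTr (P x a * P y b) / S.n := SymStrategy.corr_eq_of_isME hS'
  simp only [Game.winProb, SymStrategy.corr_eq_of_isME hS, hc]
  have hn : (S.n : ℝ) = Module.finrank ℂ S.H := by rw [S.finrank_eq]
  have hxy : ∀ x y, |∑ a, ∑ b, (if G.D x y a b then reTr (S.A x a * S.A y b) / S.n else 0)
      - ∑ a, ∑ b, (if G.D x y a b then reTr (P x a * P y b) / S.n else 0)|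
      ≤ 5 * √(S.defect x) + 5 * √(S.defect y) := fun x y => by
    have h1 := abs_sum_ite_reTr_sub_le (S.povm x).1 (S.povm x).2 (hP x).1 (hP x).2 (hPP x)
      (S.povm y).1 (S.povm y).2 (G.D x y) hn S.n_pos rfl (S.defect_nonneg x) (S.defect_le_one x)
      (hnear x)
    -- Hybrid argument: the first player already measures `P` when the second player's measurement
    -- is exchanged. Cyclicity of the trace lets the same one-sided bound apply.
    have h2 := abs_sum_ite_reTr_sub_le (S.povm y).1 (S.povm y).2 (hP y).1 (hP y).2 (hPP y)
      (hP x).1 (hP x).2 (fun b a => G.D x y a b) hn S.n_pos rfl (S.defect_nonneg y)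
      (S.defect_le_one y) (hnear y)
    simp only [fun b a => reTr_mul_comm (S.A y b) (P x a),
      fun b a => reTr_mul_comm (P y b) (P x a)] at h2
    rw [Finset.sum_comm, Finset.sum_comm (f := fun b a =>
      if G.D x y a b then reTr (P x a * P y b) / S.n else 0)] at h2
    exact (abs_sub_le _ _ _).trans (add_le_add h1 h2)
  rw [← Finset.sum_sub_distrib]
  simp only [← Finset.sum_sub_distrib, ← mul_sub]
  have hsum : ∑ x, ∑ y, G.ν.prob x y * (5 * √(S.defect x) + 5 * √(S.defect y))
      = 10 * ∑ x, G.ν.marginalA x * √(S.defect x) := by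
    have e1 : ∑ x, ∑ y, G.ν.prob x y * √(S.defect x) = ∑ x, G.ν.marginalA x * √(S.defect x) :=
      Finset.sum_congr rfl fun x _ => (Finset.sum_mul _ _ _).symm
    have e2 : ∑ x, ∑ y, G.ν.prob x y * √(S.defect y) = ∑ x, G.ν.marginalA x * √(S.defect x) := by
      rw [Finset.sum_comm, ← hG.1.marginalB_eq]
      exact Finset.sum_congr rfl fun x _ => (Finset.sum_mul _ _ _).symm
    simp only [mul_add, Finset.sum_add_distrib, mul_left_comm _ (5 : ℝ), ← Finset.mul_sum, e1, e2]
    ring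
  refine (Finset.abs_sum_le_sum_abs _ _).trans ((Finset.sum_le_sum fun x _ =>
    (Finset.abs_sum_le_sum_abs _ _).trans (Finset.sum_le_sum fun y _ => ?_)).trans
    (hsum.le.trans ?_))
  · rw [abs_mul, abs_of_nonneg (G.ν.nonneg x y)]
    refine mul_le_mul_of_nonneg_left ?_ (G.ν.nonneg x y)
    simpa only [Finset.sum_sub_distrib] using hxy x y
  · rw [S.dsync_eq_of_isME hS]
    exact mul_le_mul_of_nonneg_left (sum_mul_sqrt_le G.ν.marginalA_nonneg G.ν.sum_marginalA
      S.defect_nonneg) (by norm_num)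

end NonlocalGame

/-! ### The lemma itself -/

theorem mainTheorem7 {X : Type v} [Fintype X] {𝒜 : X → Type w} [∀ x, Fintype (𝒜 x)]
    (G : NonlocalGame.Game X 𝒜) (hG : G.IsSymm)
    (νh : NonlocalGame.PairDist X) (hνh : νh.IsSymm)
    (c : ℝ≥0) (hc : 1 ≤ c) (hcν : ∀ x, νh.marginalA x ≤ c * G.ν.marginalA x)
    (κ : ℝ≥0 → ℝ≥0)
    (St : NonlocalGame.SymStrategy.{u} X 𝒜) (hSt : St.IsPME)
    (hopt : G.IsOptimal St.toStrategy)
    (hself : NonlocalGame.RobustlySelfTests G κ νh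
      (NonlocalGame.classPME.{u} X 𝒜) St.toStrategy)
    (S : NonlocalGame.SymStrategy.{u} X 𝒜) (hS : S.IsME)
    (δ ε : ℝ≥0) (hδ : (δ : ℝ) = S.toStrategy.dsync G.ν.marginalA)
    (hε : G.winProb St.toStrategy - ε ≤ G.winProb S.toStrategy) :
    NonlocalGame.IsLocalDilation St.toStrategy S.toStrategy
      (κ (24 * NNReal.sqrt δ + ε) + 3 * √((c : ℝ) * δ)) νh := by
  open NonlocalGame in
  have hex := fun x => exists_pvm_near (S.A x) (S.povm x).1 (S.povm x).2
  choose P hP0 hP1 hPP hPQ hPn using hex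
  have hP : IsPOVMFamily P := fun x => ⟨hP0 x, hP1 x⟩
  have hPVM : IsPVMFamily P := ⟨hP, fun x => ⟨hPP x, hPQ x⟩⟩
  have hnear : ∀ x, ∑ a, reTr ((S.A x a - P x a) * (S.A x a - P x a)) ≤
      3 * (S.n * S.defect x) := fun x => by
    refine (hPn x).trans (le_of_eq ?_)
    rw [S.finrank_eq, SymStrategy.defect]
    have := S.n_pos.ne'
    field_simp
  have hwin := S.abs_winProb_sub_withMeas_le G hG hS hP hPP hnear
  rw [← hδ] at hwin
  -- `κ` is not assumed monotone, so the self-test is invoked at exactly this slack, although `10√δ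
  -- + ε` would do.
  have hdil := hself.dilation (24 * NNReal.sqrt δ + ε) (S.withMeas P hP).toStrategy
    ⟨S.withMeas P hP, ⟨hS, hPVM, isPVMFamily_transposeOp S.e hPVM⟩, rfl⟩ (by
      rw [← hopt]
      push_cast
      have := abs_le.mp hwin
      have := Real.sqrt_nonneg δ
      linarith)
  have hF : ∀ x a, (S.A x a - P x a).IsSymmetric := fun x a =>
    ((S.povm x).1 a).isSymmetric.sub (hP0 x a).isSymmetric
  have hdist : √(∑ x, νh.marginalA x *
      ∑ a, reTr ((S.A x a - P x a) * (S.A x a - P x a)) / S.n) ≤ 3 * √((c : ℝ) * δ) := by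
    refine Real.sqrt_le_iff.mpr ⟨by positivity, ?_⟩
    rw [mul_pow, Real.sq_sqrt (by positivity)]
    -- The domination by `c` moves the average from `νh` to the marginal of `G.ν`, where the mean
    -- defect is `δ`. The resulting `3cδ` is below the required `9cδ`.
    have h1 : ∑ x, νh.marginalA x * ∑ a, reTr ((S.A x a - P x a) * (S.A x a - P x a)) / S.n ≤
        ∑ x, (c * G.ν.marginalA x) * (3 * S.defect x) := by
      refine Finset.sum_le_sum fun x _ => mul_le_mul (hcν x) ?_ ?_ ?_
      · rw [← Finset.sum_div, div_le_iff₀ S.n_pos]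
        linarith [hnear x]
      · exact Finset.sum_nonneg fun a _ => div_nonneg (reTr_mul_self_nonneg (hF x a)) S.n_pos.le
      · exact mul_nonneg c.2 (G.ν.marginalA_nonneg x)
    have h2 : ∑ x, (c * G.ν.marginalA x) * (3 * S.defect x) = 3 * (c * δ) := by
      rw [hδ, S.dsync_eq_of_isME hS, Finset.mul_sum, Finset.mul_sum]
      exact Finset.sum_congr rfl fun x _ => by ring
    have h3 : (0 : ℝ) ≤ c * δ := by positivity
    linarith
  have hl : ∀ x a, ‖TensorProduct.map (S.A x a - P x a) LinearMap.id S.toStrategy.ψ‖ ^ 2 =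
      reTr ((S.A x a - P x a) * (S.A x a - P x a)) / S.n := fun x a => by
    rw [S.state_eq_of_isME hS]
    exact norm_sq_map_left_meState S.e (hF x a)
  have hr : ∀ x a, ‖TensorProduct.map LinearMap.id (transposeOp S.e (S.A x a - P x a))
      S.toStrategy.ψ‖ ^ 2 = reTr ((S.A x a - P x a) * (S.A x a - P x a)) / S.n := fun x a => by
    rw [S.state_eq_of_isME hS]
    exact norm_sq_map_right_meState S.e (hF x a)
  refine hdil.of_withMeas (by positivity) hνh ?_ ?_
  · simpa only [hl] using hdist
  · simpa only [hr] using hdist
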